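/- **Conventions.** A represented space $\mathbf X=(X,\delta_X)$ is a set $X$ with a partial surjection $\delta_X:\subseteq\mathbb N^{\mathbb N}\to X$; a $p$ with $\delta_X(p)=x$ is a name of $x$. Products are represented by $\delta_{X\times Y}\langle p,q\rangle=(\delta_X(p),\delta_Y(q))$ for the standard pairing on $\mathbb N^{\mathbb N}$, and $\mathbb N^{\mathbb N}$ is represented by the identity. A multi-valued function $f:\subseteq\mathbf X\rightrightarrows\mathbf Y$ assigns to each $x\in X$ a set $f(x)\subseteq Y$, with $\operatorname{dom}(f)=\{x: f(x)\neq\emptyset\}$. Composition: $z\in(f\circ g)(x)$ iff $g(x)\subseteq\operatorname{dom}(f)$ and $z\in f(y)$ for some $y\in g(x)$. Product: $(f\times g)(x,u)=f(x)\times g(u)$. A partial function $F:\subseteq\mathbb N^{\mathbb N}\to\mathbb N^{\mathbb N}$ realizes $f$, written $F\vdash f$, if $\delta_Y(F(p))\in f(\delta_X(p))$ for every $p$ with $\delta_X(p)\in\operatorname{dom}(f)$. One writes $f\le_{\rm W}g$ if there are computable partial functions $K,H:\subseteq\mathbb N^{\mathbb N}\to\mathbb N^{\mathbb N}$ with $K\langle\mathrm{id},GH\rangle\vdash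 f$ for all $G\vdash g$, and $f\le_{\rm sW}g$ if there are such $K,H$ with $KGH\vdash f$ for all $G\vdash g$; $\equiv_{\rm W},\equiv_{\rm sW}$ are the corresponding equivalences, and Weihrauch degrees are the classes of $\equiv_{\rm W}$. With $\mathrm{id}$ the identity of $\mathbb N^{\mathbb N}$, $f$ is a cylinder if $f\equiv_{\rm sW}\mathrm{id}\times f$. Fix a universal Type-2 Turing machine and let $\Phi_p(q)$ be its infinite output on input $\langle p,q\rangle$ (undefined if the output is finite). For represented spaces $\mathbf X,\mathbf Y$ let $\Phi_p^{\mathbf X,\mathbf Y}:\subseteq\mathbf X\rightrightarrows\mathbf Y$ be defined at $x$ iff $\Phi_p\langle a,b\rangle$ exists and lies in $\operatorname{dom}(\delta_Y)$ for all names $a$ of $x$ and all $b\in\mathbb N^{\mathbb N}$, with value the set of all these $\delta_Y(\Phi_p\langle a,b\rangle)$. Let $\mathcal M(\mathbf X,\mathbf Y)$ be the set of all $\Phi_p^{\mathbf X,\mathbf Y}$, represented by $p\mapsto\Phi_p^{\mathbf X,\mathbf Y}$. For $g:\subseteq\mathbf X\rightrightarrows\mathbf Y$ and a represented space $\mathbf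 U$ let $g^{\rm t}_{\mathbf U}:\subseteq\mathcal M(\mathbf Y,\mathbf U)\times\mathbf X\rightrightarrows\mathbf U$, $g^{\rm t}_{\mathbf U}(h,x)=(h\circ g)(x)$. For $f:\subseteq\mathbf U\rightrightarrows\mathbf V$ define the compositional product $f\star g:=(\mathrm{id}\times f)\circ g^{\rm t}_{\mathbb N^{\mathbb N}\times\mathbf U}:\subseteq\mathcal M(\mathbf Y,\mathbb N^{\mathbb N}\times\mathbf U)\times\mathbf X\rightrightarrows\mathbb N^{\mathbb N}\times\mathbf V$. **Statement.** Let $f:\subseteq\mathbf U\rightrightarrows\mathbf V$ and $g:\subseteq\mathbf X\rightrightarrows\mathbf Y$ be multi-valued functions on represented spaces, and let $S(f,g)$ be the class of all $f'\circ g'$ with $f'\le_{\rm W}f$, $g'\le_{\rm W}g$, where the target space of $g'$ is the source space of $f'$. We write $h\equiv_{\rm W}\max_{\le_{\rm W}}S$ if $h$ is Weihrauch equivalent to an element of $S$ and $k\le_{\rm W}h$ for all $k\in S$. Then: 1. If $f$ is a cylinder, then $f\circ g^{\rm t}_{\mathbf U}\equiv_{\rm W}\max_{\le_{\rm W}}S(f,g)$.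 2. $f\star g$ is a cylinder. 3. $f\star g\equiv_{\rm W}\max_{\le_{\rm W}}S(f,g)$. 4. If $f\equiv_{\rm W}f_1$ and $g\equiv_{\rm W}g_1$, then $f\star g\equiv_{\rm W}f_1\star g_1$. Hence there is exactly one (total) binary operation on Weihrauch degrees that maps the degrees of $f$ and $g$ to the degree of $f\star g$, for all $f$ and $g$. -/

import Mathlib

universe u v w x

namespace Weihrauch

/-! ### Computability on Baire space -/

/-- Baire space. -/
abbrev Baire : Type := ℕ → ℕ

/-- The standard pairing `⟨p, q⟩ = p 0, q 0, p 1, q 1, …`, a bijection from pairs of points of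
Baire space to Baire space. -/
def pair (p q : Baire) : Baire := fun n => if n % 2 = 0 then p (n / 2) else q (n / 2)

/-- First component of the pairing. -/
def fst (z : Baire) : Baire := fun n => z (2 * n)

/-- Second component of the pairing. -/
def snd (z : Baire) : Baire := fun n => z (2 * n + 1)

/-- The answer of the control program `c`, asked for the `n`-th output symbol, after the first `k`
symbols of the input tape `z` have been read: `0` means "read one more input symbol", `m + 1`
means "the `n`-th output symbol is `m`". -/
def control (c : Nat.Partrec.Code) (z : Baire) (n k : ℕ) : Part ℕ :=
  c.eval (Nat.pair n (Encodable.encode ((List.range k).map z)))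

/-- The `n`-th symbol that the machine with control program `c` and one-way input tape `z`
writes on its output tape (undefined if it is never written): the machine reads the input symbol
by symbol until the control program decides on an output. Every Type-2 Turing machine has this
form: on `n` and a finite word, the control program simulates it until it writes its `n`-th
symbol, or until it asks for an input symbol beyond the word. -/
def outputSymbol (c : Nat.Partrec.Code) (z : Baire) (n : ℕ) : Part ℕ :=
  (Nat.rfind fun k => (control c z n k).map fun a => decide (a ≠ 0)).bind
    fun k => (control c z n k).map Nat.pred

/-- The partial function on Baire space computed by the machine with control program `c`; it is
defined at `z` if and only if all output symbols are eventually written. -/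
def machine (c : Nat.Partrec.Code) : Baire → Part Baire := fun z =>
  ⟨∀ n, (outputSymbol c z n).Dom, fun h n => (outputSymbol c z n).get (h n)⟩

/-- The universal machine, on input `z`, takes the first symbol of `z` as (the number of) a program
and executes this program on `z`. -/
def universalMachine : Baire → Part Baire := fun z =>
  machine (Denumerable.ofNat Nat.Partrec.Code (z 0)) z

/-- `Φ_p(q)`: the output of the universal machine on input `⟨p, q⟩`. -/
def Phi (p : Baire) : Baire → Part Baire := fun q => universalMachine (pair p q)

/-- A partial function on Baire space is computable if some machine, with a computable index,
computes its value at every point of its domain. -/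
def IsComputable (F : Baire → Part Baire) : Prop :=
  ∃ p : Baire, Computable p ∧ ∀ q r, r ∈ F q → r ∈ Phi p q

/-! ### Represented spaces and multi-valued functions -/

/-- A represented space: a set with a partial surjection from Baire space onto it. -/
structure RepSpace where
  /-- The underlying set. -/
  carrier : Type u
  /-- The representation. -/
  rep : Baire → Part carrier
  /-- Every point has a name. -/
  surj : ∀ a : carrier, ∃ p, a ∈ rep p

/-- A partial multi-valued function `f :⊆ X ⇉ Y`; the value `∅` means "undefined". -/
abbrev MultiFun (X : RepSpace.{u}) (Y : RepSpace.{v}) : Type (max u v) :=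
  X.carrier → Set Y.carrier

/-- The domain of a multi-valued function. -/
def MultiFun.dom {X : RepSpace.{u}} {Y : RepSpace.{v}} (f : MultiFun X Y) : Set X.carrier :=
  {a | (f a).Nonempty}

/-- Composition of multi-valued functions: `z ∈ (f ∘ g)(a)` iff `g a ⊆ dom f` and `z ∈ f b` for
some `b ∈ g a`. -/
def MultiFun.comp {X : RepSpace.{u}} {Y : RepSpace.{v}} {Z : RepSpace.{w}}
    (f : MultiFun Y Z) (g : MultiFun X Y) : MultiFun X Z :=
  fun a => {z | g a ⊆ f.dom ∧ ∃ b ∈ g a, z ∈ f b}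

/-- Baire space, represented by the identity. -/
def baireSpace : RepSpace.{0} where
  carrier := Baire
  rep := fun p => Part.some p
  surj := fun p => ⟨p, Part.mem_some p⟩

theorem fst_pair (p q : Baire) : fst (pair p q) = p := by
  funext n; simp [fst, pair]

theorem snd_pair (p q : Baire) : snd (pair p q) = q := by
  funext n
  have h1 : (2 * n + 1) % 2 = 1 := by omega
  have h2 : (2 * n + 1) / 2 = n := by omega
  simp [snd, pair, h1, h2]

/-- Product of represented spaces: `⟨p, q⟩` is a name of `(a, b)` iff `p` is a name of `a` and `q`
is a name of `b`. -/
def RepSpace.prod (X : RepSpace.{u}) (Y : RepSpace.{v}) : RepSpace.{max u v} where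
  carrier := X.carrier × Y.carrier
  rep := fun z => (X.rep (fst z)).bind fun a => (Y.rep (snd z)).map fun b => (a, b)
  surj := by
    rintro ⟨a, b⟩
    obtain ⟨p, hp⟩ := X.surj a
    obtain ⟨q, hq⟩ := Y.surj b
    refine ⟨pair p q, ?_⟩
    rw [fst_pair, snd_pair]
    exact Part.mem_bind hp (Part.mem_map _ hq)

/-- The product `f × g` of multi-valued functions. -/
def MultiFun.prod {X : RepSpace.{u}} {Y : RepSpace.{v}} {U : RepSpace.{w}} {V : RepSpace.{x}}
    (f : MultiFun X Y) (g : MultiFun U V) : MultiFun (X.prod U) (Y.prod V) :=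
  fun a => f a.1 ×ˢ g a.2

/-- The identity of Baire space. -/
def idBaire : MultiFun baireSpace baireSpace := fun p => {p}

/-! ### Realizers, Weihrauch reducibility and cylinders -/

/-- `F` is a realizer of `f`: it maps every name of every point `a` of the domain of `f` to a name
of some point of `f a`. -/
def Realizes {X : RepSpace.{u}} {Y : RepSpace.{v}} (F : Baire → Part Baire) (f : MultiFun X Y) :
    Prop :=
  ∀ p a, a ∈ X.rep p → a ∈ f.dom → ∃ r ∈ F p, ∃ b ∈ Y.rep r, b ∈ f a

/-- Weihrauch reducibility: `K ⟨id, G H⟩` realizes `f` for all realizers `G` of `g`. -/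
def WLE {X : RepSpace.{u}} {Y : RepSpace.{v}} {U : RepSpace.{w}} {V : RepSpace.{x}}
    (f : MultiFun X Y) (g : MultiFun U V) : Prop :=
  ∃ K H : Baire → Part Baire, IsComputable K ∧ IsComputable H ∧
    ∀ G : Baire → Part Baire, Realizes G g →
      Realizes (fun p => ((H p).bind G).bind fun r => K (pair p r)) f

/-- Strong Weihrauch reducibility: `K G H` realizes `f` for all realizers `G` of `g`. -/
def SWLE {X : RepSpace.{u}} {Y : RepSpace.{v}} {U : RepSpace.{w}} {V : RepSpace.{x}}
    (f : MultiFun X Y) (g : MultiFun U V) : Prop :=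
  ∃ K H : Baire → Part Baire, IsComputable K ∧ IsComputable H ∧
    ∀ G : Baire → Part Baire, Realizes G g →
      Realizes (fun p => ((H p).bind G).bind K) f

/-- Weihrauch equivalence. -/
def WEquiv {X : RepSpace.{u}} {Y : RepSpace.{v}} {U : RepSpace.{w}} {V : RepSpace.{x}}
    (f : MultiFun X Y) (g : MultiFun U V) : Prop :=
  WLE f g ∧ WLE g f

/-- A cylinder: `f` is strongly Weihrauch equivalent to `id × f`. -/
def IsCylinder {X : RepSpace.{u}} {Y : RepSpace.{v}} (f : MultiFun X Y) : Prop :=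
  SWLE f (idBaire.prod f) ∧ SWLE (idBaire.prod f) f

/-! ### The space of strongly continuous multi-valued functions -/

/-- `Φ_p^{X,Y} = δ_Y ∘ Φ_p ∘ (δ_X^cyl)⁻¹`, where `δ_X^cyl ⟨a, b⟩ = δ_X a`: it is defined at `s` iff
for every name `a` of `s` and every `b` the value `Φ_p ⟨a, b⟩` is defined and a name of a point of
`Y`; its values at `s` are the points named by these `Φ_p ⟨a, b⟩`. -/
def PhiMulti (X : RepSpace.{u}) (Y : RepSpace.{v}) (p : Baire) : MultiFun X Y :=
  fun s => {t |
    (∀ a b : Baire, s ∈ X.rep a → ∃ r ∈ Phi p (pair a b), (Y.rep r).Dom) ∧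
    ∃ a b : Baire, s ∈ X.rep a ∧ ∃ r ∈ Phi p (pair a b), t ∈ Y.rep r}

/-- The represented space `M(X, Y)` of strongly continuous multi-valued functions, where `p` is a
name of `Φ_p^{X,Y}`. -/
def stronglyContinuous (X : RepSpace.{u}) (Y : RepSpace.{v}) : RepSpace.{max u v} where
  carrier := {h : MultiFun X Y // ∃ p, PhiMulti X Y p = h}
  rep := fun p => Part.some ⟨PhiMulti X Y p, p, rfl⟩
  surj := by
    rintro ⟨h, p, rfl⟩
    exact ⟨p, Part.mem_some _⟩

/-- The transposition `g^t_U :⊆ M(Y, U) × X ⇉ U, (h, a) ↦ (h ∘ g)(a)`. -/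
def transposition {X : RepSpace.{u}} {Y : RepSpace.{v}} (g : MultiFun X Y) (U : RepSpace.{w}) :
    MultiFun ((stronglyContinuous Y U).prod X) U :=
  fun s => MultiFun.comp s.1.1 g s.2

/-- The compositional product `f ⋆ g = (id × f) ∘ g^t` with `g^t` formed for the space
`ℕ^ℕ × U`. -/
def star {U : RepSpace.{u}} {V : RepSpace.{v}} {X : RepSpace.{w}} {Y : RepSpace.{x}}
    (f : MultiFun U V) (g : MultiFun X Y) :
    MultiFun ((stronglyContinuous Y (baireSpace.prod U)).prod X) (baireSpace.prod V) :=
  (idBaire.prod f).comp (transposition g (baireSpace.prod U))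

/-! ### Maxima and degrees -/

/-- A multi-valued function together with its source and target space. -/
structure Problem where
  /-- The source space. -/
  src : RepSpace.{u}
  /-- The target space. -/
  tgt : RepSpace.{u}
  /-- The multi-valued function. -/
  map : MultiFun src tgt

/-- The class `{f' ∘ g' : f' ≤_W f, g' ≤_W g}`, over all composable `f'` and `g'`. -/
def compositions {U V X Y : RepSpace.{u}} (f : MultiFun U V) (g : MultiFun X Y) :
    Set Problem.{u} :=
  {k | ∃ (A B C : RepSpace.{u}) (f' : MultiFun B C) (g' : MultiFun A B),
    WLE f' f ∧ WLE g' g ∧ k = ⟨A, C, f'.comp g'⟩}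

/-- `h ≡_W max S`: `h` is Weihrauch equivalent to an element of `S` and an upper bound of `S` with
respect to `≤_W`. -/
def IsWMax {X Y : RepSpace.{u}} (S : Set Problem.{u}) (h : MultiFun X Y) : Prop :=
  (∃ k ∈ S, WEquiv h k.map) ∧ ∀ k ∈ S, WLE k.map h

/-- The set of Weihrauch degrees, i.e. of classes with respect to Weihrauch equivalence. -/
def Degree : Type (u + 1) :=
  {S : Set Problem.{u} // ∃ f : Problem.{u}, S = {k | WEquiv k.map f.map}}

/-- The Weihrauch degree of a multi-valued function. -/
def degree {X Y : RepSpace.{u}} (f : MultiFun X Y) : Degree.{u} :=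
  ⟨{k | WEquiv k.map f}, ⟨X, Y, f⟩, rfl⟩

end Weihrauch

namespace Weihrauch

/-! The key lemma is `SWLE.comp_transposition`. Let `f'` reduce strongly to `f` via `K, H`, and let
`g'` reduce to `g` via `K', H'`. A name `p` of an instance of `f' ∘ g'` is sent to the instance `H'
p` of `g`, paired with an index of the map taking an answer `c` to `H (K' ⟨p, c⟩)`, which turns
answers of `g` into instances of `f`. Then `K` decodes the answer of `f`. Strength matters because
the final decoding no longer sees the answer of `g`.

If `f` is a cylinder, every reduction to `f` can be made strong, so `f ∘ g^t` bounds all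
compositions. It is one of them, since `g^t` reduces to `g` by evaluating `Φ` (`transposition_wle`).
For arbitrary `f`, the cylinder `id × f` is equivalent to `f`, and the class of compositions depends
only on the degrees; so `f ⋆ g` is a maximum, and maxima of one class are equivalent. For the
cylinder property, `id × (f ⋆ g)` splits as `(id × (id × f)) ∘ (id × g^t)`, to which the key lemma
applies again.

The machine model enters only through closure under composition and pairing, the smn theorem and a
universal function. These follow from `isComputable_iff_isTracked`: computable means tracked by a
computable monotone function on finite words. -/

/-! ### Tracking functions on Baire space by computable functions on finite words -/

/-- The word consisting of the first `k` symbols of `z`. -/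
def word (z : Baire) (k : ℕ) : List ℕ := (List.range k).map z

theorem word_length (z : Baire) (k : ℕ) : (word z k).length = k := by simp [word]

theorem word_succ (z : Baire) (k : ℕ) : word z (k + 1) = word z k ++ [z k] := by
  simp [word, List.range_succ]

theorem word_prefix (z : Baire) {j k : ℕ} (h : j ≤ k) : word z j <+: word z k := by
  induction h with
  | refl => exact List.prefix_rfl
  | step _ ih => exact ih.trans (by rw [word_succ]; exact List.prefix_append _ _)

theorem word_getElem? (z : Baire) {k n : ℕ} (h : n < k) : (word z k)[n]? = some (z n) := by
  simp [word, h]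

theorem word_take (z : Baire) {j k : ℕ} (h : j ≤ k) : (word z k).take j = word z j := by
  simp [word, ← List.map_take, List.take_range, h]

/-- A symbol function `T`, which from a finite word of the input may decide on the `n`-th output
symbol, is monotone if a decision is never revised when the word is extended. -/
def Monotone₂ (T : ℕ → List ℕ → Option ℕ) : Prop :=
  ∀ n a σ τ, σ <+: τ → T n σ = some a → T n τ = some a

/-- `T` decides, on the finite words of `z`, on all symbols of `F z`. -/
def Tracks (T : ℕ → List ℕ → Option ℕ) (F : Baire → Part Baire) : Prop :=
  ∀ z r, r ∈ F z → ∀ n, ∃ k, T n (word z k) = some (r n)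

/-- `F` is tracked by some computable monotone symbol function. -/
def IsTracked (F : Baire → Part Baire) : Prop :=
  ∃ T : ℕ → List ℕ → Option ℕ, Computable₂ T ∧ Monotone₂ T ∧ Tracks T F

/-- The first at most `i` output symbols that `T` decides on, given the input word `σ`. -/
def outputs (T : ℕ → List ℕ → Option ℕ) (σ : List ℕ) : ℕ → List ℕ
  | 0 => []
  | i + 1 => outputs T σ i ++ (T (outputs T σ i).length σ).toList

/-- The word function induced by a symbol function. -/
def outputWord (T : ℕ → List ℕ → Option ℕ) (σ : List ℕ) : List ℕ := outputs T σ σ.length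

theorem outputs_getElem? {T : ℕ → List ℕ → Option ℕ} {σ : List ℕ} {i n a : ℕ}
    (h : (outputs T σ i)[n]? = some a) : T n σ = some a := by
  induction i with
  | zero => simp [outputs] at h
  | succ i ih =>
    rw [outputs, List.getElem?_append] at h
    split_ifs at h with hn
    · exact ih h
    · cases hT : T (outputs T σ i).length σ with
      | none => simp [hT] at h
      | some b =>
        rw [hT] at h
        have h0 : n - (outputs T σ i).length = 0 := by
          by_contra h0
          simp [h0] at h
        have hn' : n = (outputs T σ i).length := by omega
        subst hn'
        simpa [hT] using h

theorem outputs_prefix_of_le (T : ℕ → List ℕ → Option ℕ) (σ : List ℕ) {i j : ℕ} (h : i ≤ j) :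
    outputs T σ i <+: outputs T σ j := by
  induction h with
  | refl => exact List.prefix_rfl
  | step _ ih => exact ih.trans (List.prefix_append _ _)

/-- After equally many rounds the longer word may be ahead; monotonicity then forces its extra
symbol to be the one the shorter word appends next. -/
theorem outputs_prefix {T : ℕ → List ℕ → Option ℕ} (hT : Monotone₂ T) {σ τ : List ℕ}
    (h : σ <+: τ) (i : ℕ) : outputs T σ i <+: outputs T τ i := by
  induction i with
  | zero => exact List.prefix_rfl
  | succ i ih =>
    cases hs : T (outputs T σ i).length σ with
    | none =>
      rw [outputs, hs]
      simpa using ih.trans (outputs_prefix_of_le T τ (Nat.le_succ i))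
    | some a =>
      have hs' := hT _ _ _ _ h hs
      obtain ⟨t, ht⟩ := ih
      cases t with
      | nil =>
        rw [List.append_nil] at ht
        rw [outputs, outputs, ← ht, hs, hs']
      | cons b t =>
        have hb : T (outputs T σ i).length τ = some b := by
          apply outputs_getElem? (i := i)
          rw [← ht]
          simp
        rw [hs'] at hb
        cases hb
        refine List.IsPrefix.trans ⟨t, ?_⟩ (outputs_prefix_of_le T τ (Nat.le_succ i))
        rw [outputs, hs, ← ht]
        simp

theorem outputWord_prefix {T : ℕ → List ℕ → Option ℕ} (hT : Monotone₂ T) {σ τ : List ℕ}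
    (h : σ <+: τ) : outputWord T σ <+: outputWord T τ :=
  (outputs_prefix hT h _).trans (outputs_prefix_of_le T τ h.length_le)

theorem outputs_eq_word {T : ℕ → List ℕ → Option ℕ} {σ : List ℕ} {r : Baire} {n : ℕ}
    (h : ∀ i < n, T i σ = some (r i)) : outputs T σ n = word r n := by
  induction n with
  | zero => rfl
  | succ n ih =>
    rw [outputs, ih fun i hi => h i (by omega), word_length, h n (by omega), word_succ]
    rfl

theorem Tracks.exists_prefix {T : ℕ → List ℕ → Option ℕ} {F : Baire → Part Baire}
    (hT : Monotone₂ T) (h : Tracks T F) {z r : Baire} (hr : r ∈ F z) (n : ℕ) :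
    ∃ k, word r n <+: outputWord T (word z k) := by
  choose k hk using h z r hr
  -- The sum bounds every `k i`, so all `n` symbols are decided; the summand `n` provides enough
  -- rounds, as `outputWord` makes one round per input symbol.
  let K := n + ∑ i ∈ Finset.range n, k i
  refine ⟨K, ?_⟩
  rw [outputWord, word_length,
    ← outputs_eq_word (T := T) (σ := word z K) (r := r) (n := n)]
  · exact outputs_prefix_of_le T _ (Nat.le_add_right _ _)
  · intro i hi
    refine hT _ _ _ _ (word_prefix z ?_) (hk i)
    exact (Finset.single_le_sum (fun _ _ => Nat.zero_le _) (Finset.mem_range.2 hi)).trans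
      (Nat.le_add_left _ _)

theorem computable_outputWord {T : ℕ → List ℕ → Option ℕ} (hT : Computable₂ T) :
    Computable (outputWord T) := by
  have hstep : Computable₂ fun (σ : List ℕ) (y : ℕ × List ℕ) =>
      (T y.2.length σ).elim y.2 fun a => y.2 ++ [a] := by
    have h1 : Computable fun x : List ℕ × (ℕ × List ℕ) => T x.2.2.length x.1 :=
      hT.comp (Computable.list_length.comp (Computable.snd.comp Computable.snd)) Computable.fst
    have h2 : Computable fun x : List ℕ × (ℕ × List ℕ) => x.2.2 :=
      Computable.snd.comp Computable.snd
    have h3 : Computable₂ fun (x : List ℕ × (ℕ × List ℕ)) (a : ℕ) => x.2.2 ++ [a] :=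
      (Computable.list_append.comp (h2.comp Computable.fst)
        (Computable.list_cons.comp Computable.snd (Computable.const []))).to₂
    refine (Computable.option_casesOn h1 h2 h3).of_eq ?_
    intro x
    dsimp only
    cases T x.2.2.length x.1 <;> rfl
  refine (Computable.nat_rec Computable.list_length (Computable.const []) hstep).of_eq ?_
  intro σ
  rw [outputWord]
  induction σ.length with
  | zero => rfl
  | succ i ih =>
    rw [outputs, ← ih]
    dsimp only
    cases T _ σ <;> simp

theorem getElem?_of_prefix {l m : List ℕ} {n a : ℕ} (h : l <+: m) (hl : l[n]? = some a) :
    m[n]? = some a := by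
  obtain ⟨t, rfl⟩ := h
  rw [List.getElem?_append_left, hl]
  exact (List.getElem?_eq_some_iff.1 hl).1

/-- Each symbol of the outer function depends on a finite prefix of the intermediate point, which a
finite word of the input already determines. -/
theorem IsTracked.comp {F G : Baire → Part Baire} (hF : IsTracked F) (hG : IsTracked G) :
    IsTracked fun z => (G z).bind F := by
  obtain ⟨T, hTc, hTm, hT⟩ := hF
  obtain ⟨S, hSc, hSm, hS⟩ := hG
  refine ⟨fun n σ => T n (outputWord S σ), ?_, ?_, ?_⟩
  · exact hTc.comp Computable.fst ((computable_outputWord hSc).comp Computable.snd)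
  · exact fun n a σ τ h => hTm _ _ _ _ (outputWord_prefix hSm h)
  · intro z r hr n
    obtain ⟨y, hy, hr⟩ := Part.mem_bind_iff.1 hr
    obtain ⟨j, hj⟩ := hT y r hr n
    obtain ⟨k, hk⟩ := hS.exists_prefix hSm hy j
    exact ⟨k, hTm _ _ _ _ hk hj⟩

theorem IsTracked.mono {F G : Baire → Part Baire} (hG : IsTracked G)
    (h : ∀ z r, r ∈ F z → r ∈ G z) : IsTracked F := by
  obtain ⟨T, hc, hm, hT⟩ := hG
  exact ⟨T, hc, hm, fun z r hr => hT z r (h z r hr)⟩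

theorem isTracked_const {p : Baire} (hp : Computable p) : IsTracked fun _ => Part.some p := by
  refine ⟨fun n _ => some (p n), Computable.option_some.comp (hp.comp Computable.fst),
    fun _ _ _ _ _ h => h, ?_⟩
  intro z r hr n
  rw [Part.mem_some_iff.1 hr]
  exact ⟨0, rfl⟩

theorem isTracked_reindex {e : ℕ → ℕ} (he : Computable e) :
    IsTracked fun z => Part.some fun n => z (e n) := by
  refine ⟨fun n σ => σ[e n]?, Computable.list_getElem?.comp Computable.snd
    (he.comp Computable.fst), fun _ _ _ _ h => getElem?_of_prefix h, ?_⟩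
  intro z r hr n
  rw [Part.mem_some_iff.1 hr]
  exact ⟨e n + 1, word_getElem? z (Nat.lt_succ_self _)⟩

theorem isTracked_cons (c : ℕ) :
    IsTracked fun z => Part.some fun n => n.casesOn c z := by
  refine ⟨fun n σ => n.casesOn (some c) fun m => σ[m]?, ?_, ?_, ?_⟩
  · exact Computable.nat_casesOn Computable.fst (Computable.const _)
      (Computable.list_getElem?.comp (Computable.snd.comp Computable.fst) Computable.snd).to₂
  · rintro (_ | n) a σ τ h hn
    · exact hn
    · exact getElem?_of_prefix h hn
  · intro z r hr n
    rw [Part.mem_some_iff.1 hr]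
    cases n with
    | zero => exact ⟨0, rfl⟩
    | succ n => exact ⟨n + 1, word_getElem? z (Nat.lt_succ_self _)⟩

theorem IsTracked.pair {F G : Baire → Part Baire} (hF : IsTracked F) (hG : IsTracked G) :
    IsTracked fun z => (F z).bind fun a => (G z).map (pair a) := by
  obtain ⟨T, hTc, hTm, hT⟩ := hF
  obtain ⟨S, hSc, hSm, hS⟩ := hG
  refine ⟨fun n σ => if n % 2 = 0 then T (n / 2) σ else S (n / 2) σ, ?_, ?_, ?_⟩
  · have hmod : Computable fun x : ℕ × List ℕ => decide (x.1 % 2 = 0) :=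
      (PrimrecPred.decide (Primrec.eq.comp (Primrec.nat_mod.comp Primrec.fst (Primrec.const 2))
        (Primrec.const 0))).to_comp
    have hdiv : Computable fun x : ℕ × List ℕ => x.1 / 2 :=
      (Primrec.nat_div.comp Primrec.fst (Primrec.const 2)).to_comp
    refine (Computable.cond hmod (hTc.comp hdiv Computable.snd)
      (hSc.comp hdiv Computable.snd)).of_eq ?_
    intro x
    by_cases h : x.1 % 2 = 0 <;> simp [h]
  · intro n a σ τ h
    dsimp only
    split_ifs
    · exact hTm _ _ _ _ h
    · exact hSm _ _ _ _ h
  · intro z r hr n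
    obtain ⟨a, ha, hr⟩ := Part.mem_bind_iff.1 hr
    obtain ⟨b, hb, rfl⟩ := (Part.mem_map_iff _).1 hr
    dsimp only [Weihrauch.pair]
    split_ifs
    · exact hT z a ha _
    · exact hS z b hb _

/-! ### The universal machine is tracked -/

open Nat.Partrec (Code)
open Nat.Partrec.Code (evaln evaln_mono evaln_sound evaln_complete)

/-- The answer of the control program `c` on the first `k` symbols of `σ`, if it is found within
`σ.length` steps. -/
def boundedControl (c : Code) (n : ℕ) (σ : List ℕ) (k : ℕ) : Option ℕ :=
  evaln σ.length c (Nat.pair n (Encodable.encode (σ.take k)))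

/-- The number of symbols read by the machine after at most `i` answers of its control program. -/
def symbolsRead (c : Code) (n : ℕ) (σ : List ℕ) : ℕ → ℕ
  | 0 => 0
  | i + 1 => if boundedControl c n σ (symbolsRead c n σ i) = some 0
      then symbolsRead c n σ i + 1 else symbolsRead c n σ i

/-- The symbol function of the machine with control program `c`. -/
def machineSymbol (c : Code) (n : ℕ) (σ : List ℕ) : Option ℕ :=
  (boundedControl c n σ (symbolsRead c n σ σ.length)).bind fun a => a.casesOn none some

/-- The last clause separates the two reasons to stop: the rounds are used up, or the control
program does not answer 0 within the step bound. -/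
theorem symbolsRead_spec (c : Code) (n : ℕ) (σ : List ℕ) (i : ℕ) :
    symbolsRead c n σ i ≤ i ∧ (∀ j < symbolsRead c n σ i, boundedControl c n σ j = some 0) ∧
    (symbolsRead c n σ i = i ∨ boundedControl c n σ (symbolsRead c n σ i) ≠ some 0) := by
  induction i with
  | zero => simp [symbolsRead]
  | succ i ih =>
    obtain ⟨h1, h2, h3⟩ := ih
    rw [symbolsRead]
    split_ifs with h
    · refine ⟨by omega, fun j hj => ?_, Or.inl ?_⟩
      · rcases Nat.lt_succ_iff_lt_or_eq.1 hj with hj | rfl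
        · exact h2 j hj
        · exact h
      · rcases h3 with h3 | h3
        · rw [h3]
        · exact absurd h h3
    · exact ⟨by omega, h2, Or.inr h⟩

/-- The position of the first nonzero answer is unique. This form parallels `mem_outputSymbol`, and
monotonicity can be read off from it. -/
theorem machineSymbol_eq_some {c : Code} {n : ℕ} {σ : List ℕ} {a : ℕ} :
    machineSymbol c n σ = some a ↔ ∃ k ≤ σ.length,
      (∀ j < k, boundedControl c n σ j = some 0) ∧ boundedControl c n σ k = some (a + 1) := by
  obtain ⟨h1, h2, h3⟩ := symbolsRead_spec c n σ σ.length
  constructor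
  · intro h
    refine ⟨_, h1, h2, ?_⟩
    obtain ⟨b, hb, hba⟩ := Option.bind_eq_some_iff.1 h
    cases b with
    | zero => simp at hba
    | succ b =>
      cases hba
      exact hb
  · rintro ⟨k, hk, h0, hka⟩
    have : symbolsRead c n σ σ.length = k := by
      rcases lt_trichotomy (symbolsRead c n σ σ.length) k with h | h | h
      · rcases h3 with h3 | h3
        · omega
        · exact absurd (h0 _ h) h3
      · exact h
      · rw [h2 k h] at hka
        simp at hka
    rw [machineSymbol, this, hka]
    rfl

theorem boundedControl_mono {c : Code} {n a k : ℕ} {σ τ : List ℕ} (h : σ <+: τ)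
    (hk : k ≤ σ.length) (ha : boundedControl c n σ k = some a) :
    boundedControl c n τ k = some a := by
  have : τ.take k = σ.take k := by
    obtain ⟨t, rfl⟩ := h
    exact List.take_append_of_le_length hk
  rw [boundedControl, this]
  exact evaln_mono h.length_le ha

theorem machineSymbol_mono (c : Code) : Monotone₂ (machineSymbol c) := by
  intro n a σ τ h ha
  obtain ⟨k, hk, h0, hka⟩ := machineSymbol_eq_some.1 ha
  exact machineSymbol_eq_some.2 ⟨k, hk.trans h.length_le,
    fun j hj => boundedControl_mono h (by omega) (h0 j hj), boundedControl_mono h hk hka⟩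

theorem mem_machine {c : Code} {z r : Baire} :
    r ∈ machine c z ↔ ∀ n, r n ∈ outputSymbol c z n := by
  constructor
  · rintro ⟨h, rfl⟩ n
    exact Part.get_mem (h n)
  · intro h
    exact ⟨fun n => (h n).1, funext fun n => (h n).2⟩

theorem mem_outputSymbol {c : Code} {z : Baire} {n a : ℕ} :
    a ∈ outputSymbol c z n ↔
      ∃ k, (∀ j < k, 0 ∈ control c z n j) ∧ (a + 1) ∈ control c z n k := by
  constructor
  · intro h
    obtain ⟨k, hk, ha⟩ := Part.mem_bind_iff.1 h
    obtain ⟨h1, h2⟩ := Nat.mem_rfind.1 hk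
    obtain ⟨b, hb, hba⟩ := (Part.mem_map_iff _).1 ha
    obtain ⟨b', hb', hb0⟩ := (Part.mem_map_iff _).1 h1
    cases Part.mem_unique hb hb'
    refine ⟨k, fun j hj => ?_, ?_⟩
    · obtain ⟨d, hd, hd0⟩ := (Part.mem_map_iff _).1 (h2 hj)
      have : d = 0 := by simpa using hd0
      rwa [← this]
    · have : b ≠ 0 := by simpa using hb0
      rwa [← hba, Nat.pred_eq_sub_one, Nat.sub_one_add_one this]
  · rintro ⟨k, h0, ha⟩
    refine Part.mem_bind_iff.2 ⟨k, Nat.mem_rfind.2 ⟨?_, fun {j} hj => ?_⟩, ?_⟩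
    · exact (Part.mem_map_iff _).2 ⟨_, ha, by simp⟩
    · exact (Part.mem_map_iff _).2 ⟨_, h0 j hj, by simp⟩
    · exact (Part.mem_map_iff _).2 ⟨_, ha, rfl⟩

theorem tracks_machine (c : Code) : Tracks (machineSymbol c) (machine c) := by
  intro z r hr n
  obtain ⟨k, h0, ha⟩ := mem_outputSymbol.1 (mem_machine.1 hr n)
  have hs : ∀ j : ℕ, ∃ s, j < k → 0 ∈ evaln s c (Nat.pair n (Encodable.encode (word z j))) := by
    intro j
    by_cases hj : j < k
    · obtain ⟨s, hs⟩ := evaln_complete.1 (h0 j hj)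
      exact ⟨s, fun _ => hs⟩
    · exact ⟨0, fun h => absurd h hj⟩
  choose s hs using hs
  obtain ⟨t, ht⟩ := evaln_complete.1 ha
  -- The word length is also the step bound: `k` supplies the symbols read, `t` the steps for the
  -- last answer, the sum the steps for all earlier ones.
  let K := k + t + ∑ j ∈ Finset.range k, s j
  refine ⟨K, machineSymbol_eq_some.2 ⟨k, ?_, fun j hj => ?_, ?_⟩⟩
  · rw [word_length]
    omega
  · rw [boundedControl, word_length, word_take z (by omega)]
    refine evaln_mono ?_ (hs j hj)
    exact (Finset.single_le_sum (fun _ _ => Nat.zero_le _) (Finset.mem_range.2 hj)).trans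
      (Nat.le_add_left _ _)
  · rw [boundedControl, word_length, word_take z (by omega)]
    exact evaln_mono (by omega) ht

theorem primrec_boundedControl :
    Primrec fun x : (Code × ℕ × List ℕ) × ℕ => boundedControl x.1.1 x.1.2.1 x.1.2.2 x.2 := by
  have hc : Primrec fun x : (Code × ℕ × List ℕ) × ℕ => x.1.1 := Primrec.fst.comp Primrec.fst
  have hn : Primrec fun x : (Code × ℕ × List ℕ) × ℕ => x.1.2.1 :=
    Primrec.fst.comp (Primrec.snd.comp Primrec.fst)
  have hσ : Primrec fun x : (Code × ℕ × List ℕ) × ℕ => x.1.2.2 :=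
    Primrec.snd.comp (Primrec.snd.comp Primrec.fst)
  exact Nat.Partrec.Code.primrec_evaln.comp
    (((Primrec.list_length.comp hσ).pair hc).pair (Primrec₂.natPair.comp hn
      (Primrec.encode.comp (Primrec.list_take.comp Primrec.snd hσ))))

theorem primrec_machineSymbol :
    Primrec fun x : Code × ℕ × List ℕ => machineSymbol x.1 x.2.1 x.2.2 := by
  have hstep : Primrec₂ fun (x : Code × ℕ × List ℕ) (y : ℕ × ℕ) =>
      if boundedControl x.1 x.2.1 x.2.2 y.2 = some 0 then y.2 + 1 else y.2 := by
    have h2 : Primrec fun w : (Code × ℕ × List ℕ) × ℕ × ℕ => w.2.2 :=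
      Primrec.snd.comp Primrec.snd
    exact Primrec.ite (Primrec.eq.comp (primrec_boundedControl.comp (Primrec.fst.pair h2))
      (Primrec.const (some 0))) (Primrec.succ.comp h2) h2
  have hread : Primrec fun x : Code × ℕ × List ℕ => symbolsRead x.1 x.2.1 x.2.2 x.2.2.length := by
    refine (Primrec.nat_rec' (Primrec.list_length.comp (Primrec.snd.comp Primrec.snd))
      (Primrec.const 0) hstep).of_eq ?_
    intro x
    induction x.2.2.length with
    | zero => rfl
    | succ i ih => rw [symbolsRead, ← ih]
  refine Primrec.option_bind (primrec_boundedControl.comp (Primrec.id.pair hread)) ?_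
  exact (Primrec.nat_casesOn Primrec.snd (Primrec.const none)
    (Primrec.option_some.comp Primrec.snd).to₂).to₂

theorem isTracked_universalMachine : IsTracked universalMachine := by
  refine ⟨fun n σ => σ[0]?.bind fun e => machineSymbol (Denumerable.ofNat Code e) n σ, ?_, ?_, ?_⟩
  · refine Primrec.to_comp (Primrec.option_bind (Primrec.list_getElem?.comp Primrec.snd
      (Primrec.const 0)) ?_)
    exact primrec_machineSymbol.comp (((Primrec.ofNat Code).comp Primrec.snd).pair Primrec.fst)
  · intro n a σ τ h ha
    obtain ⟨e, he, hea⟩ := Option.bind_eq_some_iff.1 ha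
    exact Option.bind_eq_some_iff.2 ⟨e, getElem?_of_prefix h he, machineSymbol_mono _ _ _ _ _ h hea⟩
  · intro z r hr n
    obtain ⟨k, hk⟩ := tracks_machine _ z r hr n
    -- At least one symbol must be visible, because the first symbol names the program.
    refine ⟨k + 1, ?_⟩
    dsimp only
    rw [word_getElem? z (Nat.succ_pos k)]
    exact machineSymbol_mono _ _ _ _ _ (word_prefix z (Nat.le_succ k)) hk

/-- Every tracked function is computed by some machine. -/
theorem IsTracked.exists_machine {F : Baire → Part Baire} (hF : IsTracked F) :
    ∃ c : Code, ∀ z r, r ∈ F z → r ∈ machine c z := by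
  obtain ⟨T, hc, hm, hT⟩ := hF
  -- The default 0 encodes "undecided" as the request to read on; a decision `a` becomes `a + 1`.
  have hcomp : Computable fun x : ℕ =>
      ((T x.unpair.1 (Denumerable.ofNat (List ℕ) x.unpair.2)).map Nat.succ).getD 0 := by
    refine Computable.option_getD (Computable.option_map ?_
      (Computable.succ.comp Computable.snd).to₂) (Computable.const 0)
    exact hc.comp (Computable.fst.comp Computable.unpair)
      ((Computable.ofNat (List ℕ)).comp (Computable.snd.comp Computable.unpair))
  obtain ⟨c, hc⟩ := Nat.Partrec.Code.exists_code.1 (Partrec.nat_iff.1 hcomp.partrec)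
  have hcontrol : ∀ z n k,
      control c z n k = Part.some (((T n (word z k)).map Nat.succ).getD 0) := by
    intro z n k
    rw [control, hc]
    simp [word]
  refine ⟨c, fun z r hr => mem_machine.2 fun n => mem_outputSymbol.2 ?_⟩
  have hex := hT z r hr n
  classical
  refine ⟨Nat.find hex, fun j hj => ?_, ?_⟩
  · rw [hcontrol]
    cases hj' : T n (word z j) with
    | none => simp
    | some a =>
      -- Minimality excludes only the answer `r n` on a shorter word; by monotonicity no other
      -- answer is possible.
      have := hm _ _ _ _ (word_prefix z hj.le) hj'
      rw [Nat.find_spec hex] at this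
      cases this
      exact absurd hj' (Nat.find_min hex hj)
  · rw [hcontrol, Nat.find_spec hex]
    simp

/-! ### Closure properties of the computable functions on Baire space -/

theorem pair_fst_snd (z : Baire) : pair (fst z) (snd z) = z := by
  funext n
  dsimp only [pair, fst, snd]
  split_ifs <;> congr 1 <;> omega

theorem isTracked_fst : IsTracked fun z => Part.some (fst z) :=
  isTracked_reindex (Primrec.nat_mul.comp (Primrec.const 2) Primrec.id).to_comp

theorem isTracked_snd : IsTracked fun z => Part.some (snd z) :=
  isTracked_reindex
    (Primrec.succ.comp (Primrec.nat_mul.comp (Primrec.const 2) Primrec.id)).to_comp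

theorem isTracked_id : IsTracked fun z => Part.some z := isTracked_reindex Computable.id

/-- The point `c, p 0, p 1, …`. -/
def cons (c : ℕ) (p : Baire) : Baire := fun n => n.casesOn c p

/-- Every tracked function of two arguments can be evaluated by `Phi`, with an index that consists
of a program and the first argument. -/
theorem IsTracked.exists_cons {F : Baire → Part Baire} (hF : IsTracked F) :
    ∃ c : ℕ, ∀ p q r, r ∈ F (Weihrauch.pair p q) → r ∈ Phi (cons c p) q := by
  -- The program must discard its own number from the front of the index before running `F`.
  have htail : IsTracked fun z => Part.some fun n => z (n + 1) := isTracked_reindex Computable.succ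
  obtain ⟨c, hc⟩ :=
    (hF.comp ((htail.comp isTracked_fst).pair isTracked_snd)).exists_machine
  refine ⟨Encodable.encode c, fun p q r hr => ?_⟩
  have : universalMachine (Weihrauch.pair (cons (Encodable.encode c) p) q) =
      machine c (Weihrauch.pair (cons (Encodable.encode c) p) q) := by
    simp [universalMachine, Weihrauch.pair, cons]
  rw [Phi, this]
  apply hc
  simp only [fst_pair, snd_pair, Part.bind_some, Part.map_some]
  exact hr

/-- One direction fixes a computable index in the universal machine; the other uses the index `c, 0,
0, …`, whose tail is a dummy first argument. -/
theorem isComputable_iff_isTracked {F : Baire → Part Baire} : IsComputable F ↔ IsTracked F := by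
  constructor
  · rintro ⟨p, hp, h⟩
    refine (isTracked_universalMachine.comp ((isTracked_const hp).pair isTracked_id)).mono ?_
    intro z r hr
    simpa [Phi] using h z r hr
  · intro hF
    obtain ⟨c, hc⟩ := (hF.comp isTracked_snd).exists_cons
    refine ⟨cons c fun _ => 0, ?_, fun q r hr => hc _ q r ?_⟩
    · exact Computable.nat_casesOn Computable.id (Computable.const c) (Computable.const 0).to₂
    · simpa [snd_pair] using hr

theorem isComputable_id : IsComputable fun z => Part.some z :=
  isComputable_iff_isTracked.2 isTracked_id

theorem isComputable_fst : IsComputable fun z => Part.some (fst z) :=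
  isComputable_iff_isTracked.2 isTracked_fst

theorem isComputable_snd : IsComputable fun z => Part.some (snd z) :=
  isComputable_iff_isTracked.2 isTracked_snd

theorem IsComputable.comp {F G : Baire → Part Baire} (hF : IsComputable F) (hG : IsComputable G) :
    IsComputable fun z => (G z).bind F :=
  isComputable_iff_isTracked.2
    ((isComputable_iff_isTracked.1 hF).comp (isComputable_iff_isTracked.1 hG))

theorem IsComputable.pair {F G : Baire → Part Baire} (hF : IsComputable F) (hG : IsComputable G) :
    IsComputable fun z => (F z).bind fun a => (G z).map (pair a) :=
  isComputable_iff_isTracked.2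
    ((isComputable_iff_isTracked.1 hF).pair (isComputable_iff_isTracked.1 hG))

theorem isComputable_phi : IsComputable fun z => Phi (fst z) (snd z) := by
  simp only [Phi, pair_fst_snd]
  exact isComputable_iff_isTracked.2 isTracked_universalMachine

/-- The smn theorem. -/
theorem IsComputable.exists_index {F : Baire → Part Baire} (hF : IsComputable F) :
    ∃ S : Baire → Baire, IsComputable (fun p => Part.some (S p)) ∧
      ∀ p q r, r ∈ F (Weihrauch.pair p q) → r ∈ Phi (S p) q := by
  obtain ⟨c, hc⟩ := (isComputable_iff_isTracked.1 hF).exists_cons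
  exact ⟨cons c, isComputable_iff_isTracked.2 (isTracked_cons c), hc⟩

/-! ### Reducibility without realizers -/

section Reducibility

universe u₁ v₁

variable {X : RepSpace.{u}} {Y : RepSpace.{v}} {U : RepSpace.{w}} {V : RepSpace.{x}}
  {A : RepSpace.{u₁}} {B : RepSpace.{v₁}}

/-- `H` maps names of points of `f.dom` to names of points of `g.dom`, and `L p` maps names of
solutions for the latter to names of solutions for the former. -/
def Reduces (f : MultiFun X Y) (g : MultiFun U V) (H : Baire → Part Baire)
    (L : Baire → Baire → Part Baire) : Prop :=
  ∀ p a, a ∈ X.rep p → a ∈ f.dom → ∃ q ∈ H p, ∃ s ∈ U.rep q, s ∈ g.dom ∧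
    ∀ r t, t ∈ V.rep r → t ∈ g s → ∃ k ∈ L p r, ∃ b ∈ Y.rep k, b ∈ f a

/-- Every multi-valued function has a realizer that takes a prescribed admissible value at a given
name. -/
theorem exists_realizer (g : MultiFun U V) {q r : Baire} {s : U.carrier} {t : V.carrier}
    (hs : s ∈ U.rep q) (ht : t ∈ V.rep r) (hst : t ∈ g s) :
    ∃ G, Realizes G g ∧ r ∈ G q := by
  classical
  have hex : ∀ p, ∃ r' : Baire, ∀ a, a ∈ U.rep p → a ∈ g.dom → ∃ b ∈ V.rep r', b ∈ g a := by
    intro p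
    by_cases hp : ∃ a ∈ U.rep p, a ∈ g.dom
    · obtain ⟨a, ha, b, hb⟩ := hp
      obtain ⟨r', hr'⟩ := V.surj b
      refine ⟨r', fun a' ha' _ => ?_⟩
      cases Part.mem_unique ha ha'
      exact ⟨b, hr', hb⟩
    · exact ⟨r, fun a ha hd => absurd ⟨a, ha, hd⟩ hp⟩
  choose G hG using hex
  refine ⟨fun p => Part.some (if p = q then r else G p), fun p a ha hd => ?_, by simp⟩
  refine ⟨_, Part.mem_some _, ?_⟩
  split_ifs with h
  · subst h
    cases Part.mem_unique ha hs
    exact ⟨t, ht, hst⟩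
  · exact hG p a ha hd

/-- Every multi-valued function has a realizer that is only defined on names of points of its
domain. -/
theorem exists_realizer_dom (g : MultiFun U V) :
    ∃ G, Realizes G g ∧ ∀ q r, r ∈ G q → ∃ s ∈ U.rep q, s ∈ g.dom := by
  classical
  have hex : ∀ p, ∃ F : Part Baire, (∀ a, a ∈ U.rep p → a ∈ g.dom →
      ∃ r ∈ F, ∃ b ∈ V.rep r, b ∈ g a) ∧ ∀ r, r ∈ F → ∃ s ∈ U.rep p, s ∈ g.dom := by
    intro p
    by_cases hp : ∃ a ∈ U.rep p, a ∈ g.dom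
    · obtain ⟨a, ha, b, hb⟩ := hp
      obtain ⟨r, hr⟩ := V.surj b
      refine ⟨Part.some r, fun a' ha' _ => ?_, fun _ _ => ⟨a, ha, b, hb⟩⟩
      cases Part.mem_unique ha ha'
      exact ⟨r, Part.mem_some r, b, hr, hb⟩
    · exact ⟨Part.none, fun a ha hd => absurd ⟨a, ha, hd⟩ hp, fun r hr => absurd hr (by simp)⟩
  choose G hG using hex
  exact ⟨G, fun p => (hG p).1, fun p => (hG p).2⟩

/-- Realizers act as adversaries: one defined only over `g.dom` forces `H` to produce names of
admissible instances, and one with a prescribed answer forces `L` to handle every answer. -/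
theorem realizes_iff_reduces {f : MultiFun X Y} {g : MultiFun U V} {H : Baire → Part Baire}
    {L : Baire → Baire → Part Baire} :
    (∀ G : Baire → Part Baire, Realizes G g →
      Realizes (fun p => ((H p).bind G).bind (L p)) f) ↔ Reduces f g H L := by
  constructor
  · intro h p a ha hd
    obtain ⟨G, hG, hGd⟩ := exists_realizer_dom g
    obtain ⟨k, hk, -⟩ := h G hG p a ha hd
    obtain ⟨r, hr, -⟩ := Part.mem_bind_iff.1 hk
    obtain ⟨q, hq, hqr⟩ := Part.mem_bind_iff.1 hr
    obtain ⟨s, hs, hsd⟩ := hGd q r hqr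
    refine ⟨q, hq, s, hs, hsd, fun r t ht hst => ?_⟩
    obtain ⟨G, hG, hGq⟩ := exists_realizer g hs ht hst
    obtain ⟨k, hk, hb⟩ := h G hG p a ha hd
    refine ⟨k, ?_, hb⟩
    obtain ⟨r', hr', hk⟩ := Part.mem_bind_iff.1 hk
    obtain ⟨q', hq', hqr'⟩ := Part.mem_bind_iff.1 hr'
    cases Part.mem_unique hq hq'
    cases Part.mem_unique hGq hqr'
    exact hk
  · intro h G hG p a ha hd
    obtain ⟨q, hq, s, hs, hsd, hL⟩ := h p a ha hd
    obtain ⟨r, hr, t, ht, hst⟩ := hG q s hs hsd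
    obtain ⟨k, hk, hb⟩ := hL r t ht hst
    exact ⟨k, Part.mem_bind (Part.mem_bind hq hr) hk, hb⟩

theorem wle_iff {f : MultiFun X Y} {g : MultiFun U V} :
    WLE f g ↔ ∃ K H : Baire → Part Baire, IsComputable K ∧ IsComputable H ∧
      Reduces f g H fun p r => K (pair p r) := by
  simp only [WLE, realizes_iff_reduces]

theorem swle_iff {f : MultiFun X Y} {g : MultiFun U V} :
    SWLE f g ↔ ∃ K H : Baire → Part Baire, IsComputable K ∧ IsComputable H ∧
      Reduces f g H fun _ r => K r := by
  simp only [SWLE, ← realizes_iff_reduces]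

theorem SWLE.wle {f : MultiFun X Y} {g : MultiFun U V} (h : SWLE f g) : WLE f g := by
  obtain ⟨K, H, hK, hH, h⟩ := swle_iff.1 h
  refine wle_iff.2 ⟨_, H, hK.comp isComputable_snd, hH, ?_⟩
  simpa [snd_pair] using h

theorem SWLE.refl (f : MultiFun X Y) : SWLE f f :=
  swle_iff.2 ⟨_, _, isComputable_id, isComputable_id, fun p a ha hd =>
    ⟨p, Part.mem_some _, a, ha, hd, fun r t ht hst => ⟨r, Part.mem_some _, t, ht, hst⟩⟩⟩

theorem WLE.refl (f : MultiFun X Y) : WLE f f := (SWLE.refl f).wle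

theorem SWLE.trans {f : MultiFun X Y} {g : MultiFun U V} {h : MultiFun A B}
    (hfg : SWLE f g) (hgh : SWLE g h) : SWLE f h := by
  obtain ⟨K, H, hK, hH, hfg⟩ := swle_iff.1 hfg
  obtain ⟨K', H', hK', hH', hgh⟩ := swle_iff.1 hgh
  refine swle_iff.2 ⟨_, _, hK.comp hK', hH'.comp hH, fun p a ha hd => ?_⟩
  obtain ⟨q, hq, s, hs, hsd, hback⟩ := hfg p a ha hd
  obtain ⟨q', hq', s', hs', hsd', hback'⟩ := hgh q s hs hsd
  refine ⟨q', Part.mem_bind hq hq', s', hs', hsd', fun r t ht hst => ?_⟩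
  obtain ⟨k, hk, b, hb, hbs⟩ := hback' r t ht hst
  obtain ⟨k', hk', hb'⟩ := hback k b hb hbs
  exact ⟨k', Part.mem_bind hk hk', hb'⟩

theorem mem_pair_bind {F G : Part Baire} {p q : Baire} (hp : p ∈ F) (hq : q ∈ G) :
    pair p q ∈ F.bind fun a => G.map (pair a) :=
  Part.mem_bind hp (Part.mem_map _ hq)

theorem WLE.trans {f : MultiFun X Y} {g : MultiFun U V} {h : MultiFun A B}
    (hfg : WLE f g) (hgh : WLE g h) : WLE f h := by
  obtain ⟨K, H, hK, hH, hfg⟩ := wle_iff.1 hfg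
  obtain ⟨K', H', hK', hH', hgh⟩ := wle_iff.1 hgh
  -- `K'` expects the name of the intermediate instance, so `H p` is recomputed from the original
  -- input.
  refine wle_iff.2 ⟨_, _, hK.comp (isComputable_fst.pair
    (hK'.comp ((hH.comp isComputable_fst).pair isComputable_snd))), hH'.comp hH,
    fun p a ha hd => ?_⟩
  obtain ⟨q, hq, s, hs, hsd, hback⟩ := hfg p a ha hd
  obtain ⟨q', hq', s', hs', hsd', hback'⟩ := hgh q s hs hsd
  refine ⟨q', Part.mem_bind hq hq', s', hs', hsd', fun r t ht hst => ?_⟩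
  obtain ⟨k, hk, b, hb, hbs⟩ := hback' r t ht hst
  obtain ⟨k', hk', hb'⟩ := hback k b hb hbs
  refine ⟨k', ?_, hb'⟩
  simp only [fst_pair, snd_pair]
  exact Part.mem_bind (mem_pair_bind (Part.mem_some _) (Part.mem_bind
    (mem_pair_bind (Part.mem_bind (Part.mem_some _) hq) (Part.mem_some _)) hk)) hk'

theorem WEquiv.refl (f : MultiFun X Y) : WEquiv f f := ⟨WLE.refl f, WLE.refl f⟩

theorem WEquiv.symm {f : MultiFun X Y} {g : MultiFun U V} (h : WEquiv f g) : WEquiv g f :=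
  ⟨h.2, h.1⟩

theorem WEquiv.trans {f : MultiFun X Y} {g : MultiFun U V} {h : MultiFun A B}
    (hfg : WEquiv f g) (hgh : WEquiv g h) : WEquiv f h :=
  ⟨hfg.1.trans hgh.1, hgh.2.trans hfg.2⟩

/-! ### Cylinders -/

theorem mem_prod_rep {z : Baire} {a : X.carrier × Y.carrier} :
    a ∈ (X.prod Y).rep z ↔ a.1 ∈ X.rep (fst z) ∧ a.2 ∈ Y.rep (snd z) := by
  obtain ⟨a, b⟩ := a
  constructor
  · intro h
    obtain ⟨a', ha, h⟩ := Part.mem_bind_iff.1 h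
    obtain ⟨b', hb, h⟩ := (Part.mem_map_iff _).1 h
    cases h
    exact ⟨ha, hb⟩
  · exact fun h => Part.mem_bind h.1 (Part.mem_map _ h.2)

theorem mem_prod_rep_pair {p q : Baire} {a : X.carrier × Y.carrier} :
    a ∈ (X.prod Y).rep (pair p q) ↔ a.1 ∈ X.rep p ∧ a.2 ∈ Y.rep q := by
  rw [mem_prod_rep, fst_pair, snd_pair]

theorem mem_dom_id_prod {f : MultiFun X Y} {a : Baire × X.carrier} :
    a ∈ (idBaire.prod f).dom ↔ a.2 ∈ f.dom :=
  ⟨fun ⟨b, hb⟩ => ⟨b.2, hb.2⟩, fun ⟨b, hb⟩ => ⟨(a.1, b), rfl, hb⟩⟩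

theorem mem_baireSpace_rep {p q : Baire} : p ∈ baireSpace.rep q ↔ p = q := Part.mem_some_iff

theorem swle_id_prod (f : MultiFun X Y) : SWLE f (idBaire.prod f) := by
  refine swle_iff.2 ⟨_, _, isComputable_snd, isComputable_id.pair isComputable_id,
    fun p a ha hd => ?_⟩
  refine ⟨_, mem_pair_bind (Part.mem_some _) (Part.mem_some _), (p, a),
    mem_prod_rep_pair.2 ⟨mem_baireSpace_rep.2 rfl, ha⟩, mem_dom_id_prod.2 hd, ?_⟩
  intro r t ht hst
  exact ⟨_, Part.mem_some _, t.2, (mem_prod_rep.1 ht).2, hst.2⟩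

/-- A reduction to `f` is a strong reduction to `id × f`. -/
theorem WLE.swle_id_prod {f : MultiFun X Y} {g : MultiFun U V} (h : WLE f g) :
    SWLE f (idBaire.prod g) := by
  obtain ⟨K, H, hK, hH, h⟩ := wle_iff.1 h
  refine swle_iff.2 ⟨K, _, hK, isComputable_id.pair hH, fun p a ha hd => ?_⟩
  obtain ⟨q, hq, s, hs, hsd, hback⟩ := h p a ha hd
  refine ⟨_, mem_pair_bind (Part.mem_some _) hq, (p, s),
    mem_prod_rep_pair.2 ⟨mem_baireSpace_rep.2 rfl, hs⟩, mem_dom_id_prod.2 hsd, ?_⟩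
  intro r t ht hst
  obtain ⟨ht1, ht2⟩ := mem_prod_rep.1 ht
  obtain ⟨k, hk, hb⟩ := hback _ t.2 ht2 hst.2
  refine ⟨k, ?_, hb⟩
  -- The identity component has preserved `p`, so `r` is already the pair that `K` expects.
  have h1 : t.1 = p := hst.1
  rw [← pair_fst_snd r, ← mem_baireSpace_rep.1 ht1, h1]
  exact hk

theorem id_prod_wle (f : MultiFun X Y) : WLE (idBaire.prod f) f := by
  refine wle_iff.2 ⟨_, _, (isComputable_fst.comp isComputable_fst).pair isComputable_snd,
    isComputable_snd, fun p a ha hd => ?_⟩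
  obtain ⟨ha1, ha2⟩ := mem_prod_rep.1 ha
  refine ⟨_, Part.mem_some _, a.2, ha2, mem_dom_id_prod.1 hd, fun r t ht hst => ?_⟩
  refine ⟨_, mem_pair_bind (Part.mem_bind (Part.mem_some _) (Part.mem_some _)) (Part.mem_some _),
    (a.1, t), mem_prod_rep_pair.2 ⟨?_, ?_⟩, rfl, hst⟩
  · rwa [fst_pair]
  · rwa [snd_pair]

theorem id_prod_wequiv (f : MultiFun X Y) : WEquiv (idBaire.prod f) f :=
  ⟨id_prod_wle f, (Weihrauch.swle_id_prod f).wle⟩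

/-- Both identity factors can be dropped by ordinary reductions to `f`; one copy of `id` then
suffices to make the combined reduction strong. -/
theorem isCylinder_id_prod (f : MultiFun X Y) : IsCylinder (idBaire.prod f) :=
  ⟨swle_id_prod _, ((id_prod_wle _).trans (id_prod_wle f)).swle_id_prod⟩

theorem WLE.swle_of_isCylinder {f : MultiFun X Y} {g : MultiFun U V} (h : WLE f g)
    (hg : IsCylinder g) : SWLE f g :=
  h.swle_id_prod.trans hg.2

/-! ### Transposition -/

theorem mem_dom_comp {f : MultiFun Y U} {g : MultiFun X Y} {a : X.carrier} :
    a ∈ (f.comp g).dom ↔ a ∈ g.dom ∧ g a ⊆ f.dom := by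
  constructor
  · rintro ⟨z, h, b, hb, -⟩
    exact ⟨⟨b, hb⟩, h⟩
  · rintro ⟨⟨b, hb⟩, h⟩
    obtain ⟨z, hz⟩ := h hb
    exact ⟨z, h, b, hb, hz⟩

theorem id_prod_comp (f : MultiFun Y U) (g : MultiFun X Y) :
    idBaire.prod (f.comp g) = (idBaire.prod f).comp (idBaire.prod g) := by
  funext ⟨q, a⟩
  ext ⟨q', z⟩
  constructor
  · rintro ⟨hq, h, b, hb, hz⟩
    exact ⟨fun y hy => mem_dom_id_prod.2 (h hy.2), (q', b), ⟨hq, hb⟩, rfl, hz⟩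
  · rintro ⟨h, b, hb, hq, hz⟩
    have hq' : q' = b.1 := hq
    exact ⟨hq'.trans hb.1, fun y hy => mem_dom_id_prod.1 (h (a := (q, y)) ⟨rfl, hy⟩),
      b.2, hb.2, hz⟩

theorem mem_stronglyContinuous_rep {p : Baire} {h : (stronglyContinuous X Y).carrier} :
    h ∈ (stronglyContinuous X Y).rep p ↔ h.1 = PhiMulti X Y p := by
  refine Part.mem_some_iff.trans ⟨fun h => by rw [h], fun h => Subtype.ext h⟩

theorem transposition_wle (g : MultiFun X Y) (U : RepSpace.{w}) : WLE (transposition g U) g := by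
  refine wle_iff.2 ⟨_, _, isComputable_phi.comp ((isComputable_fst.comp isComputable_fst).pair
    (isComputable_snd.pair isComputable_snd)), isComputable_snd, fun p a ha hd => ?_⟩
  obtain ⟨ha1, ha2⟩ := mem_prod_rep.1 ha
  rw [mem_stronglyContinuous_rep] at ha1
  obtain ⟨hg, hsub⟩ := mem_dom_comp.1 hd
  refine ⟨_, Part.mem_some _, a.2, ha2, hg, fun r t ht hst => ?_⟩
  obtain ⟨c, hc⟩ := hsub hst
  rw [ha1] at hc
  -- Any second argument of `Φ` is admissible; `r` is reused for convenience.
  obtain ⟨k, hk, hkd⟩ := hc.1 r r ht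
  refine ⟨k, ?_, (U.rep k).get hkd, Part.get_mem _, hsub, t, hst, ?_⟩
  · refine Part.mem_bind (mem_pair_bind (Part.mem_bind (Part.mem_some _) (Part.mem_some _))
      (mem_pair_bind (Part.mem_some _) (Part.mem_some _))) ?_
    simpa only [fst_pair, snd_pair] using hk
  · rw [ha1]
    exact ⟨hc.1, r, r, ht, k, hk, Part.get_mem _⟩

/-- Every point has a name, so the totality clause alone yields a value. -/
theorem mem_dom_phiMulti {p : Baire} {s : X.carrier} :
    s ∈ (PhiMulti X Y p).dom ↔
      ∀ a b : Baire, s ∈ X.rep a → ∃ r ∈ Phi p (pair a b), (Y.rep r).Dom := by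
  constructor
  · rintro ⟨t, h, -⟩
    exact h
  · intro h
    obtain ⟨a, ha⟩ := X.surj s
    obtain ⟨r, hr, hd⟩ := h a a ha
    exact ⟨_, h, a, a, ha, r, hr, Part.get_mem hd⟩

end Reducibility

/-! ### Composing reductions through the transposition -/

section Composition

universe u₁ v₁ w₁

variable {U : RepSpace.{u}} {V : RepSpace.{v}} {X : RepSpace.{w}} {Y : RepSpace.{x}}
  {A : RepSpace.{u₁}} {B : RepSpace.{v₁}} {C : RepSpace.{w₁}}

/-- Strong reductions to `f` and reductions to `g` compose to a strong reduction to the composition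
of `f` with the transposition of `g`. -/
theorem SWLE.comp_transposition {f : MultiFun U V} {g : MultiFun X Y} {f' : MultiFun B C}
    {g' : MultiFun A B} (hf : SWLE f' f) (hg : WLE g' g) :
    SWLE (f'.comp g') (f.comp (transposition g U)) := by
  obtain ⟨K, H, hK, hH, hf⟩ := swle_iff.1 hf
  obtain ⟨K', H', hK', hH', hg⟩ := wle_iff.1 hg
  -- `S p` is an index of the map `⟨c, d⟩ ↦ H (K' ⟨p, c⟩)`, which ignores the auxiliary argument
  -- `d`.
  obtain ⟨S, hS, hSΦ⟩ := (hH.comp (hK'.comp (isComputable_fst.pair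
    (isComputable_fst.comp isComputable_snd)))).exists_index
  refine swle_iff.2 ⟨K, _, hK, hS.pair hH', fun p a ha hd => ?_⟩
  obtain ⟨hdg, hsub⟩ := mem_dom_comp.1 hd
  obtain ⟨q, hq, s, hs, hsd, hback⟩ := hg p a ha hdg
  -- the value of `Φ_{S p}` at a name `c` of a solution `y` of `g s`
  have key : ∀ y ∈ g s, ∀ c d, y ∈ Y.rep c → ∃ r ∈ Phi (S p) (pair c d), ∃ t ∈ U.rep r,
      t ∈ f.dom ∧ ∃ b ∈ g' a, ∀ k v, v ∈ V.rep k → v ∈ f t →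
        ∃ k' ∈ K k, ∃ e ∈ C.rep k', e ∈ f' b := by
    intro y hy c d hc
    obtain ⟨k, hk, b, hb, hba⟩ := hback c y hc hy
    obtain ⟨r, hr, t, ht, htd, hback'⟩ := hf k b hb (hsub hba)
    refine ⟨r, hSΦ p _ r (Part.mem_bind (Part.mem_bind (mem_pair_bind (Part.mem_some _)
      (Part.mem_bind (Part.mem_some _) (Part.mem_some _))) ?_) hr), t, ht, htd, b, hba, hback'⟩
    simpa only [fst_pair, snd_pair] using hk
  have hdom : g s ⊆ (PhiMulti Y U (S p)).dom := fun y hy =>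
    mem_dom_phiMulti.2 fun c d hc => by
      obtain ⟨r, hr, t, ht, -⟩ := key y hy c d hc
      exact ⟨r, hr, ht.1⟩
  -- Different names of one solution may yield different instances of `f`, so a multi-valued `h` is
  -- needed.
  let h : (stronglyContinuous Y U).carrier := ⟨PhiMulti Y U (S p), S p, rfl⟩
  refine ⟨_, mem_pair_bind (Part.mem_some _) hq, (h, s),
    mem_prod_rep_pair.2 ⟨mem_stronglyContinuous_rep.2 rfl, hs⟩, ?_, ?_⟩
  · refine mem_dom_comp.2 ⟨mem_dom_comp.2 ⟨hsd, hdom⟩, ?_⟩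
    rintro t ⟨-, y, hy, -, c, d, hc, r, hr, ht⟩
    obtain ⟨r', hr', t', ht', htd, -⟩ := key y hy c d hc
    cases Part.mem_unique hr hr'
    cases Part.mem_unique ht ht'
    exact htd
  · rintro k v hv ⟨-, t, ⟨-, y, hy, -, c, d, hc, r, hr, ht⟩, hvt⟩
    obtain ⟨r', hr', t', ht', htd, b, hb, hback'⟩ := key y hy c d hc
    cases Part.mem_unique hr hr'
    cases Part.mem_unique ht ht'
    obtain ⟨k', hk', e, he, heb⟩ := hback' k v hv hvt
    exact ⟨k', hk', e, he, hsub, b, hb, heb⟩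

end Composition

/-! ### The compositional product -/

section Star

variable {U V X Y U' V' X' Y' : RepSpace.{u}}

theorem isWMax_comp_transposition {f : MultiFun U V} (g : MultiFun X Y) (hf : IsCylinder f) :
    IsWMax (compositions f g) (f.comp (transposition g U)) := by
  refine ⟨⟨_, ⟨_, _, _, f, transposition g U, WLE.refl f, transposition_wle g U, rfl⟩,
    WEquiv.refl _⟩, ?_⟩
  rintro _ ⟨A, B, C, f', g', hf', hg', rfl⟩
  exact ((hf'.swle_of_isCylinder hf).comp_transposition hg').wle

theorem compositions_congr {f : MultiFun U V} {g : MultiFun X Y} {f' : MultiFun U' V'}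
    {g' : MultiFun X' Y'} (hf : WEquiv f f') (hg : WEquiv g g') :
    compositions f g = compositions f' g' := by
  ext k
  constructor
  · rintro ⟨A, B, C, h, h', hh, hh', rfl⟩
    exact ⟨A, B, C, h, h', hh.trans hf.1, hh'.trans hg.1, rfl⟩
  · rintro ⟨A, B, C, h, h', hh, hh', rfl⟩
    exact ⟨A, B, C, h, h', hh.trans hf.2, hh'.trans hg.2, rfl⟩

/-- Replacing `f` by the equivalent cylinder `id × f` leaves the class of compositions unchanged. -/
theorem isWMax_star (f : MultiFun U V) (g : MultiFun X Y) :
    IsWMax (compositions f g) (star f g) := by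
  rw [← compositions_congr (id_prod_wequiv f) (WEquiv.refl g)]
  exact isWMax_comp_transposition g (isCylinder_id_prod f)

theorem IsWMax.wle {S : Set Problem.{u}} {h : MultiFun X Y} {h' : MultiFun U V}
    (hS : IsWMax S h) (hS' : IsWMax S h') : WLE h h' := by
  obtain ⟨k, hk, hhk⟩ := hS.1
  exact hhk.1.trans (hS'.2 k hk)

theorem star_congr {f : MultiFun U V} {g : MultiFun X Y} {f' : MultiFun U' V'}
    {g' : MultiFun X' Y'} (hf : WEquiv f f') (hg : WEquiv g g') :
    WEquiv (star f g) (star f' g') := by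
  have hfg := isWMax_star f g
  have hmax := isWMax_star f' g'
  rw [← compositions_congr hf hg] at hmax
  exact ⟨hfg.wle hmax, hmax.wle hfg⟩

/-- `id × (f ⋆ g)` strongly reduces to `f ⋆ g` since it is a composition of `id × (id × f)`, which
strongly reduces to `id × f`, with a multi-valued function that reduces to `g`. -/
theorem isCylinder_star (f : MultiFun U V) (g : MultiFun X Y) : IsCylinder (star f g) := by
  refine ⟨swle_id_prod _, ?_⟩
  have hf : SWLE (idBaire.prod (idBaire.prod f)) (idBaire.prod f) := (isCylinder_id_prod f).2
  have hg : WLE (idBaire.prod (transposition g (baireSpace.prod U))) g :=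
    (id_prod_wle _).trans (transposition_wle g _)
  rw [star, id_prod_comp]
  exact hf.comp_transposition hg

/-! ### The induced operation on Weihrauch degrees -/

theorem degree_eq_iff {f : MultiFun U V} {g : MultiFun X Y} :
    degree f = degree g ↔ WEquiv f g := by
  constructor
  · intro h
    have hmem : (⟨U, V, f⟩ : Problem) ∈ (degree f).1 := WEquiv.refl f
    rw [h] at hmem
    exact hmem
  · intro h
    refine Subtype.ext (Set.ext fun k => ⟨fun hk => ?_, fun hk => ?_⟩)
    · exact WEquiv.trans hk h
    · exact WEquiv.trans hk h.symm

theorem exists_degree_eq (d : Degree.{u}) : ∃ f : Problem.{u}, degree f.map = d := by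
  obtain ⟨_, f, rfl⟩ := d
  exact ⟨f, rfl⟩

theorem existsUnique_degree_operation :
    ∃! op : Degree.{u} → Degree.{u} → Degree.{u},
      ∀ (U V X Y : RepSpace.{u}) (f : MultiFun U V) (g : MultiFun X Y),
        op (degree f) (degree g) = degree (star f g) := by
  -- Chosen representatives define the operation; `star_congr` makes the choice immaterial, and
  -- uniqueness holds because every degree has a representative.
  choose r hr using exists_degree_eq.{u}
  refine ⟨fun d e => degree (star (r d).map (r e).map), fun U V X Y f g => ?_, fun op hop => ?_⟩
  · exact degree_eq_iff.2 (star_congr (degree_eq_iff.1 (hr _)) (degree_eq_iff.1 (hr _)))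
  · funext d e
    rw [← hop, hr, hr]

end Star

end Weihrauch

open Weihrauch in
theorem corollary18 :
    (∀ (U V X Y : RepSpace.{u}) (f : MultiFun U V) (g : MultiFun X Y), IsCylinder f →
      IsWMax (compositions f g) (f.comp (transposition g U))) ∧
    (∀ (U V X Y : RepSpace.{u}) (f : MultiFun U V) (g : MultiFun X Y), IsCylinder (star f g)) ∧
    (∀ (U V X Y : RepSpace.{u}) (f : MultiFun U V) (g : MultiFun X Y),
      IsWMax (compositions f g) (star f g)) ∧
    (∀ (U V X Y U' V' X' Y' : RepSpace.{u}) (f : MultiFun U V) (g : MultiFun X Y)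
      (f' : MultiFun U' V') (g' : MultiFun X' Y'),
      WEquiv f f' → WEquiv g g' → WEquiv (star f g) (star f' g')) ∧
    (∃! op : Degree.{u} → Degree.{u} → Degree.{u},
      ∀ (U V X Y : RepSpace.{u}) (f : MultiFun U V) (g : MultiFun X Y),
        op (degree f) (degree g) = degree (star f g)) :=
  ⟨fun _ _ _ _ _ g hf => isWMax_comp_transposition g hf,
    fun _ _ _ _ f g => isCylinder_star f g,
    fun _ _ _ _ f g => isWMax_star f g,
    fun _ _ _ _ _ _ _ _ _ _ _ _ hf hg => star_congr hf hg,
    existsUnique_degree_operation⟩
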